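/- Let $K$ be a field of characteristic $0$ and let $a\in K$ be nonzero but otherwise arbitrary (for example $a$ any nonzero rational number with $K=\mathbb Q$, or $a$ an indeterminate with $K=\mathbb Q(a)$). Consider the equation $$xyz(x+y+z)=a. \qquad (*)$$ **I. The curve and its points.** Let $s\in K$, $s\ne 0$. 1. For nonzero $A,B,C\in K$, the triple $$x=\frac{A^2}{2s^3C},\qquad y=\frac{2aB^2}{s^3AC},\qquad z=\frac{sC}{2B}$$ satisfies $(*)$ if and only if $A^3B+4aB^3+s^4C^2A-4s^8C^2=0$. If moreover $B=4s^4-A$, this holds if and only if $(A,V)$ with $V=s^2C$ lies on $$E:\ V^2=A^3+4aA^2-32s^4aA+64as^8 .$$ Say that a triple $(x,y,z)$ *comes from* a (nonsingular, affine) point $(A,V)$ of $E$ if it is given by the formulas above with $B=4s^4-A$ and $C=V/s^2$ or $C=-V/s^2$, where $A,B,C$ are all nonzero. Every triple that comes from a point of $E$ satisfies $(*)$. 2. $P=(s^4-4a,\ s^6+12as^2)$ is a nonsingular point of $E$, and, if $s^4-4a$, $3s^4+4a$ and $s^4+12a$ are nonzero, Elkies's solution $$x=\frac{(s^4-4a)^2}{2s^3(s^4+12a)},\quad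 y=\frac{2a(3s^4+4a)^2}{s^3(s^4-4a)(s^4+12a)},\quad z=\frac{s(s^4+12a)}{2(3s^4+4a)}$$ comes from $P$. 3. Put $f_1=s^{12}-460s^8a-208s^4a^2-64a^3$, $f_2=s^8+56s^4a+16a^2$, $f_3=s^8-32s^4a-16a^2$, $f_4=s^{16}+1136s^{12}a-928s^8a^2+1792s^4a^3+256a^4$. If $s^4+12a\neq0$, then $$2P=\left(\frac{s^{16}-464s^{12}a+1632s^8a^2+768s^4a^3+256a^4}{4s^4(s^4+12a)^2},\ \frac{f_3f_4}{8s^6(s^4+12a)^3}\right).$$ If in addition $s^4-4a$, $5s^4-4a$, $3s^4+4a$, $f_1,f_2,f_3,f_4$ are nonzero, then the triple $$x=\frac{-(s^4-4a)^2f_1^2}{4s^3(s^4+12a)f_3f_4},\quad y=\frac{-4as(s^4+12a)(5s^4-4a)^2(3s^4+4a)^2f_2^2}{f_4f_3(s^4-4a)f_1},\quad z=\frac{-f_3f_4}{4s^3(5s^4-4a)(3s^4+4a)f_2(s^4+12a)}$$ comes from $2P$. **II. Infinitely many parametric solutions.** Now let $s$ be an indeterminate over $K$, and regard $E$ and $P$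 over the rational function field $K(s)$. Then $E$ is an elliptic curve and $P$ has infinite order in $E(K(s))$. Elkies's solution comes from $P$, and the solution of I.3 comes from $2P$ and differs from $\pm$ Elkies's solution. For every nonzero integer $n$ some triple in $K(s)^3$ comes from $nP$, and the set of all solutions of $(*)$ in $K(s)^3$ that come from multiples $nP$ ($n\in\mathbb Z$) is infinite. Thus Elkies's family contains infinitely many parametric solutions. -/

import Mathlib

namespace ElkiesFamily

/-- The triple `(x, y, z)` satisfies `x y z (x + y + z) = a`. -/
def IsSolution {F : Type*} [Field F] (a : F) (T : F × F × F) : Prop :=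
  T.1 * T.2.1 * T.2.2 * (T.1 + T.2.1 + T.2.2) = a

/-- Elkies's form: `x = A² / (2 s³ C)`, `y = 2 a B² / (s³ A C)`, `z = s C / (2 B)`. -/
def form {F : Type*} [Field F] (a s A B C : F) : F × F × F :=
  (A ^ 2 / (2 * s ^ 3 * C), 2 * a * B ^ 2 / (s ^ 3 * A * C), s * C / (2 * B))

/-- The curve `E : V² = A³ + 4 a A² - 32 s⁴ a A + 64 a s⁸` in the coordinates `(A, V)`. -/
def curve {F : Type*} [Field F] (a s : F) : WeierstrassCurve.Affine F where
  a₁ := 0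
  a₂ := 4 * a
  a₃ := 0
  a₄ := -(32 * s ^ 4 * a)
  a₆ := 64 * a * s ^ 8

theorem basePoint_nonsingular {F : Type*} [Field F] [CharZero F] (a s : F) (ha : a ≠ 0) :
    (curve a s).Nonsingular (s ^ 4 - 4 * a) (s ^ 6 + 12 * a * s ^ 2) := by
  rw [WeierstrassCurve.Affine.nonsingular_iff, WeierstrassCurve.Affine.equation_iff]
  simp only [curve]
  refine ⟨by ring, ?_⟩
  by_contra! h
  obtain ⟨h1, h2⟩ := h
  have h3 : s ^ 2 * (s ^ 4 + 12 * a) = 0 := by linear_combination h2 / 2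
  have h4 : a ^ 2 = 0 := by
    rcases mul_eq_zero.1 h3 with h | h
    · have hs : s ^ 4 = 0 := by linear_combination s ^ 2 * h
      linear_combination (-1 / 16) * h1 + (-(3 * s ^ 4 - 24 * a + 8 * a - 32 * a) / 16) * hs
    · have hs : s ^ 4 = -12 * a := by linear_combination h
      rw [hs] at h1
      linear_combination (-1 / 1024) * h1
  exact ha (pow_eq_zero_iff two_ne_zero |>.1 h4)

/-- The point `P = (s⁴ - 4 a, s⁶ + 12 a s²)` of `E`. -/
def basePoint {F : Type*} [Field F] [CharZero F] (a s : F) (ha : a ≠ 0) : (curve a s).Point :=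
  .some (s ^ 4 - 4 * a) (s ^ 6 + 12 * a * s ^ 2) (basePoint_nonsingular a s ha)

/-- The triple `T` comes from the point `Q = (A, V)` of `E`: with `B = 4 s⁴ - A` and one of the
two `C` with `s⁴ C² = V²` (that is, `C = ± V / s²`), all of `A`, `B`, `C` are nonzero, so that
Elkies's form has no vanishing denominator, and `T` is its value. -/
def ComesFrom {F : Type*} [Field F] (a s : F) (Q : (curve a s).Point) (T : F × F × F) : Prop :=
  ∃ (A V C : F) (h : (curve a s).Nonsingular A V),
    Q = .some A V h ∧ s ^ 4 * C ^ 2 = V ^ 2 ∧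
    A ≠ 0 ∧ 4 * s ^ 4 - A ≠ 0 ∧ C ≠ 0 ∧ T = form a s A (4 * s ^ 4 - A) C

/-- Elkies's solution. -/
def elkiesSolution {F : Type*} [Field F] (a s : F) : F × F × F :=
  ((s ^ 4 - 4 * a) ^ 2 / (2 * s ^ 3 * (s ^ 4 + 12 * a)),
   2 * a * (3 * s ^ 4 + 4 * a) ^ 2 / (s ^ 3 * (s ^ 4 - 4 * a) * (s ^ 4 + 12 * a)),
   s * (s ^ 4 + 12 * a) / (2 * (3 * s ^ 4 + 4 * a)))

/-- Auxiliary polynomial factors of the second solution. -/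
def f₁ {F : Type*} [Field F] (a s : F) : F :=
  s ^ 12 - 460 * s ^ 8 * a - 208 * a ^ 2 * s ^ 4 - 64 * a ^ 3

def f₂ {F : Type*} [Field F] (a s : F) : F := s ^ 8 + 56 * s ^ 4 * a + 16 * a ^ 2

def f₃ {F : Type*} [Field F] (a s : F) : F := s ^ 8 - 32 * s ^ 4 * a - 16 * a ^ 2

def f₄ {F : Type*} [Field F] (a s : F) : F :=
  s ^ 16 + 1136 * s ^ 12 * a - 928 * s ^ 8 * a ^ 2 + 1792 * a ^ 3 * s ^ 4 + 256 * a ^ 4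

/-- The explicit second solution. -/
def newSolution {F : Type*} [Field F] (a s : F) : F × F × F :=
  (-((s ^ 4 - 4 * a) ^ 2 * f₁ a s ^ 2) / (4 * s ^ 3 * (s ^ 4 + 12 * a) * f₃ a s * f₄ a s),
   -(4 * a * s * (s ^ 4 + 12 * a) * (5 * s ^ 4 - 4 * a) ^ 2 * (3 * s ^ 4 + 4 * a) ^ 2
      * f₂ a s ^ 2) / (f₄ a s * f₃ a s * (s ^ 4 - 4 * a) * f₁ a s),
   -(f₃ a s * f₄ a s) /
      (4 * s ^ 3 * (5 * s ^ 4 - 4 * a) * (3 * s ^ 4 + 4 * a) * f₂ a s * (s ^ 4 + 12 * a)))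

/-- The curve `E` over the rational function field `K(s)`, for a constant `a` of `K`. -/
noncomputable abbrev genericCurve {K : Type*} [Field K] (a : K) : WeierstrassCurve.Affine (RatFunc K) :=
  curve (RatFunc.C a) RatFunc.X

/-- The point `P` of `E` over `K(s)`. -/
noncomputable abbrev genericPoint {K : Type*} [Field K] [CharZero K]
    (a : K) (ha : a ≠ 0) : (genericCurve a).Point :=
  basePoint (RatFunc.C a) RatFunc.X ((map_ne_zero RatFunc.C).2 ha)

end ElkiesFamily

namespace ElkiesFamily

/-! ### Identities on the curve over an arbitrary field of characteristic zero. -/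

section Field

variable {F : Type*} [Field F]

/-! The claims for a fixed `s` are rational function identities. The generic claims come from
specialising at `s = ∞`. With `A = s⁴ p`, `V = s⁶ q`, `t = a / s⁴` the curve becomes `q² = p³ + 4 t
p² - 32 t p + 64 t`, and `t` vanishes at infinity, leaving the cuspidal cubic `q² = p³`. Its smooth
points form the additive group under `p / q`, and `P` reduces to `(1, 1)`, of parameter `1`. So `n
P` reduces to the point of parameter `n`, namely `(1 / n², 1 / n³)`
(`nsmul_genericPoint_hasValueAtInfty`), affine because the characteristic is zero. Hence `P` has
infinite order, and `A`, `4 s⁴ - A`, `V` never vanish at `n P` for `n ≥ 1`. The value `1 / (2 n)²`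
of `(x / s)²` then separates the solutions coming from different positive multiples
(`ComesFrom.ne_of_ne`). -/

theorem isSolution_form_iff [CharZero F] {a s A B C : F} (ha : a ≠ 0) (hs : s ≠ 0) (hA : A ≠ 0)
    (hB : B ≠ 0) (hC : C ≠ 0) : IsSolution a (form a s A B C) ↔
      A ^ 3 * B + 4 * a * B ^ 3 + s ^ 4 * C ^ 2 * A - 4 * s ^ 8 * C ^ 2 = 0 := by
  have key : (form a s A B C).1 * (form a s A B C).2.1 * (form a s A B C).2.2 *
      ((form a s A B C).1 + (form a s A B C).2.1 + (form a s A B C).2.2) - a =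
      a * (A ^ 3 * B + 4 * a * B ^ 3 + s ^ 4 * C ^ 2 * A - 4 * s ^ 8 * C ^ 2) /
        (4 * s ^ 8 * C ^ 2) := by
    simp only [form]
    field_simp
    ring
  rw [IsSolution, ← sub_eq_zero, key]
  simp [ha, hs, hC]

/-- The choice of `B` turns the two terms in `C²` into `-s⁴ C² B`, so `B` divides the whole relation
and the quotient is the cubic. -/
theorem isSolution_form_iff_curve [CharZero F] {a s A C : F} (ha : a ≠ 0) (hs : s ≠ 0)
    (hA : A ≠ 0) (hB : 4 * s ^ 4 - A ≠ 0) (hC : C ≠ 0) :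
    IsSolution a (form a s A (4 * s ^ 4 - A) C) ↔
      (s ^ 2 * C) ^ 2 = A ^ 3 + 4 * a * A ^ 2 - 32 * s ^ 4 * a * A + 64 * a * s ^ 8 := by
  rw [isSolution_form_iff ha hs hA hB hC]
  have key : A ^ 3 * (4 * s ^ 4 - A) + 4 * a * (4 * s ^ 4 - A) ^ 3 + s ^ 4 * C ^ 2 * A -
      4 * s ^ 8 * C ^ 2 = (4 * s ^ 4 - A) *
        (A ^ 3 + 4 * a * A ^ 2 - 32 * s ^ 4 * a * A + 64 * a * s ^ 8 - (s ^ 2 * C) ^ 2) := by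
    ring
  rw [key, mul_eq_zero, or_iff_right hB, sub_eq_zero, eq_comm]

theorem equation_curve_iff {a s A V : F} : (curve a s).Equation A V ↔
    V ^ 2 = A ^ 3 + 4 * a * A ^ 2 - 32 * s ^ 4 * a * A + 64 * a * s ^ 8 := by
  rw [WeierstrassCurve.Affine.equation_iff]
  simp only [curve]
  ring_nf

theorem ComesFrom.isSolution [CharZero F] {a s : F} (ha : a ≠ 0) (hs : s ≠ 0)
    {Q : (curve a s).Point} {T : F × F × F} (h : ComesFrom a s Q T) : IsSolution a T := by
  obtain ⟨A, V, C, hQ, -, hV, hA, hB, hC, rfl⟩ := h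
  rw [isSolution_form_iff_curve ha hs hA hB hC, ← equation_curve_iff.1 hQ.1, ← hV]
  ring

theorem comesFrom_elkiesSolution [CharZero F] {a s : F} (ha : a ≠ 0)
    (h₁ : s ^ 4 - 4 * a ≠ 0) (h₂ : 3 * s ^ 4 + 4 * a ≠ 0) (h₃ : s ^ 4 + 12 * a ≠ 0) :
    ComesFrom a s (basePoint a s ha) (elkiesSolution a s) := by
  have hB : 4 * s ^ 4 - (s ^ 4 - 4 * a) = 3 * s ^ 4 + 4 * a := by ring
  refine ⟨_, _, s ^ 4 + 12 * a, basePoint_nonsingular a s ha, rfl, by ring, h₁, hB ▸ h₂, h₃, ?_⟩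
  rw [form, hB, elkiesSolution]

theorem two_nsmul_basePoint [CharZero F] [DecidableEq F] {a s : F} (ha : a ≠ 0) (hs : s ≠ 0)
    (h : s ^ 4 + 12 * a ≠ 0) : ∃ h, 2 • basePoint a s ha = .some
      ((s ^ 16 - 464 * s ^ 12 * a + 1632 * s ^ 8 * a ^ 2 + 768 * a ^ 3 * s ^ 4 + 256 * a ^ 4) /
        (4 * s ^ 4 * (s ^ 4 + 12 * a) ^ 2))
      (f₃ a s * f₄ a s / (8 * s ^ 6 * (s ^ 4 + 12 * a) ^ 3)) h := by
  have hV : s ^ 6 + 12 * a * s ^ 2 = s ^ 2 * (s ^ 4 + 12 * a) := by ring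
  have hne : s ^ 6 + 12 * a * s ^ 2 ≠
      (curve a s).negY (s ^ 4 - 4 * a) (s ^ 6 + 12 * a * s ^ 2) := by
    intro h0
    have : 2 * (s ^ 2 * (s ^ 4 + 12 * a)) = 0 := by
      simp only [WeierstrassCurve.Affine.negY, curve] at h0
      linear_combination h0
    simp [hs, h] at this
  have hslope : (curve a s).slope (s ^ 4 - 4 * a) (s ^ 4 - 4 * a) (s ^ 6 + 12 * a * s ^ 2)
      (s ^ 6 + 12 * a * s ^ 2) =
      (3 * s ^ 8 - 48 * s ^ 4 * a + 16 * a ^ 2) / (2 * s ^ 2 * (s ^ 4 + 12 * a)) := by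
    rw [WeierstrassCurve.Affine.slope_of_Y_ne rfl hne]
    simp only [WeierstrassCurve.Affine.negY, curve, hV]
    have : s ^ 2 * (s ^ 4 + 12 * a) - (-(s ^ 2 * (s ^ 4 + 12 * a)) - 0 * (s ^ 4 - 4 * a) - 0) =
      2 * s ^ 2 * (s ^ 4 + 12 * a) := by ring
    rw [this]
    ring
  -- An opaque `d` lets `field_simp` treat the denominator as an atom; it is expanded again only for
  -- `ring`.
  obtain ⟨d, hd⟩ : ∃ d, d = s ^ 4 + 12 * a := ⟨_, rfl⟩
  have hX : (curve a s).addX (s ^ 4 - 4 * a) (s ^ 4 - 4 * a)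
      ((3 * s ^ 8 - 48 * s ^ 4 * a + 16 * a ^ 2) / (2 * s ^ 2 * (s ^ 4 + 12 * a))) =
      (s ^ 16 - 464 * s ^ 12 * a + 1632 * s ^ 8 * a ^ 2 + 768 * a ^ 3 * s ^ 4 + 256 * a ^ 4) /
        (4 * s ^ 4 * (s ^ 4 + 12 * a) ^ 2) := by
    simp only [WeierstrassCurve.Affine.addX, curve]
    rw [← hd] at h ⊢
    field_simp
    rw [hd]
    ring
  have hadd := WeierstrassCurve.Affine.Point.add_self_of_Y_ne
    (h₁ := basePoint_nonsingular a s ha) hne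
  have hY : (curve a s).addY (s ^ 4 - 4 * a) (s ^ 4 - 4 * a) (s ^ 6 + 12 * a * s ^ 2)
      ((3 * s ^ 8 - 48 * s ^ 4 * a + 16 * a ^ 2) / (2 * s ^ 2 * (s ^ 4 + 12 * a))) =
      f₃ a s * f₄ a s / (8 * s ^ 6 * (s ^ 4 + 12 * a) ^ 3) := by
    simp only [WeierstrassCurve.Affine.addY, WeierstrassCurve.Affine.negAddY, hX]
    simp only [WeierstrassCurve.Affine.negY, curve, f₃, f₄]
    rw [← hd] at h ⊢
    field_simp
    rw [hd]
    ring
  simp only [hslope, hX, hY] at hadd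
  exact ⟨_, (two_nsmul _).trans hadd⟩

theorem comesFrom_newSolution [CharZero F] [DecidableEq F] {a s : F} (ha : a ≠ 0) (hs : s ≠ 0)
    (h₁ : s ^ 4 + 12 * a ≠ 0) (h₂ : s ^ 4 - 4 * a ≠ 0) (h₃ : 5 * s ^ 4 - 4 * a ≠ 0)
    (h₄ : 3 * s ^ 4 + 4 * a ≠ 0) (hf₁ : f₁ a s ≠ 0) (hf₂ : f₂ a s ≠ 0) (hf₃ : f₃ a s ≠ 0)
    (hf₄ : f₄ a s ≠ 0) : ComesFrom a s (2 • basePoint a s ha) (newSolution a s) := by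
  obtain ⟨h, hP⟩ := two_nsmul_basePoint ha hs h₁
  have hA : (s ^ 16 - 464 * s ^ 12 * a + 1632 * s ^ 8 * a ^ 2 + 768 * a ^ 3 * s ^ 4 +
      256 * a ^ 4) / (4 * s ^ 4 * (s ^ 4 + 12 * a) ^ 2) =
      (s ^ 4 - 4 * a) * f₁ a s / (4 * s ^ 4 * (s ^ 4 + 12 * a) ^ 2) := by
    simp only [f₁]
    ring
  obtain ⟨d, hd⟩ : ∃ d, d = s ^ 4 + 12 * a := ⟨_, rfl⟩
  have hB : 4 * s ^ 4 - (s ^ 4 - 4 * a) * f₁ a s / (4 * s ^ 4 * (s ^ 4 + 12 * a) ^ 2) =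
      (5 * s ^ 4 - 4 * a) * (3 * s ^ 4 + 4 * a) * f₂ a s /
        (4 * s ^ 4 * (s ^ 4 + 12 * a) ^ 2) := by
    simp only [f₁, f₂]
    rw [← hd] at h₁ ⊢
    field_simp
    rw [hd]
    ring
  -- The root `C = -V / s²` accounts for the minus signs in `newSolution`.
  refine ⟨_, _, -(f₃ a s * f₄ a s / (8 * s ^ 8 * (s ^ 4 + 12 * a) ^ 3)), h, hP, ?_, ?_, ?_, ?_, ?_⟩
  · field_simp
  · rw [hA]
    simp [hs, h₁, h₂, hf₁]
  · rw [hA, hB]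
    simp [hs, h₁, h₃, h₄, hf₂]
  · simp [hs, h₁, hf₃, hf₄]
  · rw [hA, hB, form, newSolution]
    refine Prod.ext ?_ (Prod.ext ?_ ?_)
    · field_simp
      ring
    · field_simp
      ring
    · field_simp
      ring

theorem isElliptic_curve [CharZero F] {a s : F} (ha : a ≠ 0) (hs : s ≠ 0)
    (h : 27 * s ^ 4 + 4 * a ≠ 0) : (curve a s).IsElliptic := by
  have hΔ : (curve a s).Δ = -(65536 * a ^ 2 * s ^ 12 * (27 * s ^ 4 + 4 * a)) := by
    simp only [WeierstrassCurve.Δ, WeierstrassCurve.b₂, WeierstrassCurve.b₄, WeierstrassCurve.b₆,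
      WeierstrassCurve.b₈, curve]
    ring
  refine ⟨isUnit_iff_ne_zero.2 ?_⟩
  rw [hΔ]
  simp [ha, hs, h]

end Field

end ElkiesFamily
namespace ElkiesFamily

/-! ### Values at infinity and reduction of the multiples of `P` to the cusp. -/

section RatFunc

variable {K : Type*} [Field K] [DecidableEq (RatFunc K)]

/-- The rational function `f` is finite at infinity and takes the value `c` there. -/
def HasValueAtInfty (f : RatFunc K) (c : K) : Prop :=
  RatFunc.inftyValuation K (f - RatFunc.C c) < 1

namespace HasValueAtInfty

variable {f g : RatFunc K} {c d : K}

theorem valuation_C_le_one (c : K) : RatFunc.inftyValuation K (RatFunc.C c) ≤ 1 := by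
  by_cases hc : c = 0
  · simp [hc]
  · exact (RatFunc.inftyValuation.C K hc).le

theorem valuation_le_one (hf : HasValueAtInfty f c) : RatFunc.inftyValuation K f ≤ 1 := by
  rw [← sub_add_cancel f (RatFunc.C c)]
  exact Valuation.map_add_le _ (le_of_lt hf) (valuation_C_le_one c)

theorem C (c : K) : HasValueAtInfty (RatFunc.C c) c := by
  simp [HasValueAtInfty]

theorem one : HasValueAtInfty (1 : RatFunc K) 1 := by
  simpa using C (1 : K)

theorem ofNat (n : ℕ) [n.AtLeastTwo] :
    HasValueAtInfty (OfNat.ofNat n : RatFunc K) (OfNat.ofNat n) := by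
  simpa only [map_ofNat] using C (OfNat.ofNat n : K)

theorem inv_X : HasValueAtInfty (RatFunc.X⁻¹ : RatFunc K) 0 := by
  rw [HasValueAtInfty, map_zero, sub_zero, map_inv₀, RatFunc.inftyValuation.X,
    ← WithZero.exp_neg, ← WithZero.exp_zero, WithZero.exp_lt_exp]
  norm_num

theorem add (hf : HasValueAtInfty f c) (hg : HasValueAtInfty g d) :
    HasValueAtInfty (f + g) (c + d) := by
  rw [HasValueAtInfty, map_add, add_sub_add_comm]
  exact Valuation.map_add_lt _ hf hg

theorem neg (hf : HasValueAtInfty f c) : HasValueAtInfty (-f) (-c) := by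
  rw [HasValueAtInfty, map_neg, ← neg_sub', Valuation.map_neg]
  exact hf

theorem sub (hf : HasValueAtInfty f c) (hg : HasValueAtInfty g d) :
    HasValueAtInfty (f - g) (c - d) := by
  simpa only [sub_eq_add_neg] using hf.add hg.neg

theorem mul (hf : HasValueAtInfty f c) (hg : HasValueAtInfty g d) :
    HasValueAtInfty (f * g) (c * d) := by
  have h : f * g - RatFunc.C (c * d) =
      (f - RatFunc.C c) * g + RatFunc.C c * (g - RatFunc.C d) := by
    rw [map_mul]
    ring
  rw [HasValueAtInfty, h]
  refine Valuation.map_add_lt _ ?_ ?_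
  · rw [map_mul]
    exact (mul_le_of_le_one_right' hg.valuation_le_one).trans_lt hf
  · rw [map_mul]
    exact (mul_le_of_le_one_left' (valuation_C_le_one c)).trans_lt hg

theorem pow (hf : HasValueAtInfty f c) (n : ℕ) : HasValueAtInfty (f ^ n) (c ^ n) := by
  induction n with
  | zero => simpa using one
  | succ n ih => simpa only [pow_succ] using ih.mul hf

/-- A nonzero constant has valuation `1`, so two distinct constants cannot both be within valuation
`< 1` of `f`. -/
theorem unique (hf : HasValueAtInfty f c) (hf' : HasValueAtInfty f d) : c = d := by
  by_contra h
  have := Valuation.map_sub_lt _ hf' hf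
  rw [sub_sub_sub_cancel_left, ← map_sub, RatFunc.inftyValuation.C K (sub_ne_zero.2 h)] at this
  exact this.false

theorem ne_zero (hf : HasValueAtInfty f c) (hc : c ≠ 0) : f ≠ 0 := by
  rintro rfl
  exact hc (hf.unique (by simpa using C (0 : K)))

theorem valuation_eq_one (hf : HasValueAtInfty f c) (hc : c ≠ 0) :
    RatFunc.inftyValuation K f = 1 := by
  rw [← RatFunc.inftyValuation.C K hc]
  refine Valuation.map_eq_of_sub_lt _ ?_
  rwa [RatFunc.inftyValuation.C K hc]

theorem inv (hf : HasValueAtInfty f c) (hc : c ≠ 0) : HasValueAtInfty f⁻¹ c⁻¹ := by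
  have hf0 := hf.ne_zero hc
  have hC : RatFunc.C c ≠ 0 := (map_ne_zero _).2 hc
  have h : f⁻¹ - RatFunc.C c⁻¹ = -(f - RatFunc.C c) * (f⁻¹ * (RatFunc.C c)⁻¹) := by
    rw [map_inv₀]
    field_simp
    ring
  rw [HasValueAtInfty, h, map_mul, Valuation.map_neg, map_mul, map_inv₀, map_inv₀,
    hf.valuation_eq_one hc, RatFunc.inftyValuation.C K hc]
  simp only [inv_one, mul_one]
  exact hf

theorem div (hf : HasValueAtInfty f c) (hg : HasValueAtInfty g d) (hd : d ≠ 0) :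
    HasValueAtInfty (f / g) (c / d) := by
  simpa only [div_eq_mul_inv] using hf.mul (hg.inv hd)

/-- The parameter `a / X ^ 4` of the rescaled curve vanishes at infinity. -/
theorem parameter (a : K) : HasValueAtInfty (RatFunc.C a * RatFunc.X⁻¹ ^ 4) 0 := by
  simpa using (C a).mul (inv_X.pow 4)

end HasValueAtInfty

open HasValueAtInfty in
/-- In the coordinates `(A / X ^ 4, V / X ^ 6)` the curve has a cusp at infinity, and there the
positive multiple `n P` takes the value `(1 / n ^ 2, 1 / n ^ 3)`. -/
theorem nsmul_genericPoint_hasValueAtInfty [CharZero K] {a : K} (ha : a ≠ 0) {n : ℕ}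
    (hn : 1 ≤ n) : ∃ p q h,
      n • genericPoint a ha = .some (RatFunc.X ^ 4 * p) (RatFunc.X ^ 6 * q) h ∧
      HasValueAtInfty p (1 / (n : K) ^ 2) ∧ HasValueAtInfty q (1 / (n : K) ^ 3) := by
  have hX := RatFunc.X_ne_zero (K := K)
  obtain ⟨t, ht⟩ : ∃ t, t = RatFunc.C a * RatFunc.X⁻¹ ^ 4 := ⟨_, rfl⟩
  have ht0 : HasValueAtInfty t 0 := ht ▸ parameter a
  have hat : RatFunc.C a = RatFunc.X ^ 4 * t := by
    rw [ht]
    field_simp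
  have hp₁ : HasValueAtInfty (1 - 4 * t) 1 := by
    simpa using one.sub ((ofNat 4).mul ht0)
  have hq₁ : HasValueAtInfty (1 + 12 * t) 1 := by
    simpa using one.add ((ofNat 12).mul ht0)
  have hP : ∃ h, genericPoint a ha =
      .some (RatFunc.X ^ 4 * (1 - 4 * t)) (RatFunc.X ^ 6 * (1 + 12 * t)) h := by
    have hx : RatFunc.X ^ 4 - 4 * RatFunc.C a = RatFunc.X ^ 4 * (1 - 4 * t) := by
      rw [hat]; ring
    have hy : RatFunc.X ^ 6 + 12 * RatFunc.C a * RatFunc.X ^ 2 = RatFunc.X ^ 6 * (1 + 12 * t) := by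
      rw [hat]; ring
    have h := basePoint_nonsingular (RatFunc.C a) RatFunc.X ((map_ne_zero RatFunc.C).2 ha)
    simp only [hx, hy] at h
    refine ⟨h, ?_⟩
    simp only [genericPoint, basePoint, hx, hy]
  obtain ⟨hP₀, hP⟩ := hP
  -- the sum of two points depends only on the rescaled slope of the line through them
  have hadd : ∀ (p q l : RatFunc K) (b c e : K)
      (h : (genericCurve a).Nonsingular (RatFunc.X ^ 4 * p) (RatFunc.X ^ 6 * q))
      (hne : ¬(RatFunc.X ^ 4 * p = RatFunc.X ^ 4 * (1 - 4 * t) ∧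
        RatFunc.X ^ 6 * q = (genericCurve a).negY (RatFunc.X ^ 4 * (1 - 4 * t))
          (RatFunc.X ^ 6 * (1 + 12 * t))))
      (hl : (genericCurve a).slope (RatFunc.X ^ 4 * p) (RatFunc.X ^ 4 * (1 - 4 * t))
        (RatFunc.X ^ 6 * q) (RatFunc.X ^ 6 * (1 + 12 * t)) = RatFunc.X ^ 2 * l),
      HasValueAtInfty p b → HasValueAtInfty q c → HasValueAtInfty l e →
      ∃ p' q' h', .some _ _ h + genericPoint a ha =
        .some (RatFunc.X ^ 4 * p') (RatFunc.X ^ 6 * q') h' ∧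
        HasValueAtInfty p' (e ^ 2 - b - 1) ∧
        HasValueAtInfty q' (-(e * (e ^ 2 - b - 1 - b) + c)) := by
    intro p q l b c e h hne hl hp hq hle
    have hsum := WeierstrassCurve.Affine.Point.add_some hne (h₁ := h) (h₂ := hP₀)
    rw [← hP] at hsum
    have hx : (genericCurve a).addX (RatFunc.X ^ 4 * p) (RatFunc.X ^ 4 * (1 - 4 * t))
        (RatFunc.X ^ 2 * l) = RatFunc.X ^ 4 * (l ^ 2 - 4 * t - p - (1 - 4 * t)) := by
      simp only [WeierstrassCurve.Affine.addX, curve, hat]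
      ring
    have hy : (genericCurve a).addY (RatFunc.X ^ 4 * p) (RatFunc.X ^ 4 * (1 - 4 * t))
        (RatFunc.X ^ 6 * q) (RatFunc.X ^ 2 * l) =
        RatFunc.X ^ 6 * -(l * (l ^ 2 - 4 * t - p - (1 - 4 * t) - p) + q) := by
      simp only [WeierstrassCurve.Affine.addY, WeierstrassCurve.Affine.negAddY, hx]
      simp only [WeierstrassCurve.Affine.negY, curve]
      ring
    simp only [hl, hx, hy] at hsum
    have hp' : HasValueAtInfty (l ^ 2 - 4 * t - p - (1 - 4 * t)) (e ^ 2 - b - 1) := by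
      simpa using (((hle.pow 2).sub ((ofNat 4).mul ht0)).sub hp).sub hp₁
    exact ⟨_, _, _, hsum, hp', ((hle.mul (hp'.sub hp)).add hq).neg⟩
  induction n, hn using Nat.le_induction with
  | base => exact ⟨_, _, hP₀, by rw [one_smul, hP], by simpa using hp₁, by simpa using hq₁⟩
  | succ n hn ih =>
    obtain ⟨p, q, h, hnP, hp, hq⟩ := ih
    have hn0 : (n : K) ≠ 0 := by exact_mod_cast (by omega : n ≠ 0)
    have hn1 : (n : K) + 1 ≠ 0 := by exact_mod_cast (by omega : n + 1 ≠ 0)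
    -- The limit is the slope of the chord of `q² = p³` through the points of parameters `n` and
    -- `1`; at `n = 1` it gives the tangent slope `3 / 2`, so one formula serves both cases.
    suffices H : ∃ l, ¬(RatFunc.X ^ 4 * p = RatFunc.X ^ 4 * (1 - 4 * t) ∧
        RatFunc.X ^ 6 * q = (genericCurve a).negY (RatFunc.X ^ 4 * (1 - 4 * t))
          (RatFunc.X ^ 6 * (1 + 12 * t))) ∧
        (genericCurve a).slope (RatFunc.X ^ 4 * p) (RatFunc.X ^ 4 * (1 - 4 * t))
          (RatFunc.X ^ 6 * q) (RatFunc.X ^ 6 * (1 + 12 * t)) = RatFunc.X ^ 2 * l ∧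
        HasValueAtInfty l (((n : K) ^ 2 + n + 1) / (n * (n + 1))) by
      obtain ⟨l, hne, hl, hle⟩ := H
      obtain ⟨p', q', h', hs, hp', hq'⟩ := hadd p q l _ _ _ h hne hl hp hq hle
      refine ⟨p', q', h', by rw [succ_nsmul, hnP, hs], ?_, ?_⟩
      · convert hp' using 1
        push_cast
        field_simp
        ring
      · convert hq' using 1
        push_cast
        field_simp
        ring
    rcases hn.eq_or_lt with rfl | hn
    · obtain ⟨hxp, hyq⟩ : RatFunc.X ^ 4 * p = RatFunc.X ^ 4 * (1 - 4 * t) ∧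
          RatFunc.X ^ 6 * q = RatFunc.X ^ 6 * (1 + 12 * t) := by
        simpa [hP] using hnP.symm
      have hq0 := hq₁.ne_zero one_ne_zero
      have hne : RatFunc.X ^ 6 * q ≠ (genericCurve a).negY (RatFunc.X ^ 4 * (1 - 4 * t))
          (RatFunc.X ^ 6 * (1 + 12 * t)) := by
        rw [hyq]
        intro h0
        have : 2 * (RatFunc.X ^ 6 * (1 + 12 * t)) = 0 := by
          simp only [WeierstrassCurve.Affine.negY, curve] at h0
          linear_combination h0
        simp [hX, hq0] at this
      -- Tangent slope `(3 p² + 8 t p - 32 t) / (2 q)` of the rescaled cubic at `P`.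
      refine ⟨(3 * (1 - 4 * t) ^ 2 + 8 * t * (1 - 4 * t) - 32 * t) / (2 * (1 + 12 * t)),
        fun h0 => hne h0.2, ?_, ?_⟩
      · rw [WeierstrassCurve.Affine.slope_of_Y_ne hxp hne, hxp, hyq]
        have hden : RatFunc.X ^ 6 * (1 + 12 * t) - (genericCurve a).negY
            (RatFunc.X ^ 4 * (1 - 4 * t)) (RatFunc.X ^ 6 * (1 + 12 * t)) =
            RatFunc.X ^ 6 * (2 * (1 + 12 * t)) := by
          simp only [WeierstrassCurve.Affine.negY, curve]
          ring
        have hnum : 3 * (RatFunc.X ^ 4 * (1 - 4 * t)) ^ 2 +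
            2 * (genericCurve a).a₂ * (RatFunc.X ^ 4 * (1 - 4 * t)) + (genericCurve a).a₄ -
            (genericCurve a).a₁ * (RatFunc.X ^ 6 * (1 + 12 * t)) =
            RatFunc.X ^ 8 * (3 * (1 - 4 * t) ^ 2 + 8 * t * (1 - 4 * t) - 32 * t) := by
          simp only [curve, hat]
          ring
        rw [hden, hnum]
        field_simp
      · have hnum := ((((ofNat 3).mul (hp₁.pow 2)).add (((ofNat 8).mul ht0).mul hp₁)).sub
          ((ofNat 32).mul ht0)).div ((ofNat 2).mul hq₁) (by norm_num)
        convert hnum using 1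
        norm_num
    -- For `n ≥ 2` the abscissas of `n P` and `P` already differ at infinity, so the chord formula
    -- applies.
    · have hn2 : (n : K) - 1 ≠ 0 := sub_ne_zero.2 (by exact_mod_cast hn.ne')
      have hdiff := hp.sub hp₁
      have hd0 : 1 / (n : K) ^ 2 - 1 ≠ 0 := by
        have : 1 / (n : K) ^ 2 - 1 = -((n - 1) * (n + 1) / (n : K) ^ 2) := by
          field_simp
          ring
        rw [this]
        simp [hn0, hn1, hn2]
      have hd := hdiff.ne_zero hd0
      have hxne : RatFunc.X ^ 4 * p ≠ RatFunc.X ^ 4 * (1 - 4 * t) := fun h0 =>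
        hd (sub_eq_zero.2 (mul_left_cancel₀ (pow_ne_zero 4 hX) h0))
      refine ⟨(q - (1 + 12 * t)) / (p - (1 - 4 * t)), fun h0 => hxne h0.1, ?_, ?_⟩
      · rw [WeierstrassCurve.Affine.slope_of_X_ne hxne, ← mul_sub, ← mul_sub]
        field_simp
      · convert (hq.sub hq₁).div hdiff hd0 using 1
        rw [eq_div_iff hd0]
        field_simp
        ring

end RatFunc

end ElkiesFamily
namespace ElkiesFamily

/-! ### Infinite order and distinctness of the parametric solutions. -/

section Generic

variable {K : Type*} [Field K] [CharZero K] [DecidableEq (RatFunc K)]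

open HasValueAtInfty

theorem nsmul_genericPoint_coordinates_ne_zero {a : K} (ha : a ≠ 0) {n : ℕ} (hn : 1 ≤ n) :
    ∃ A V h, n • genericPoint a ha = .some A V h ∧ A ≠ 0 ∧ 4 * RatFunc.X ^ 4 - A ≠ 0 ∧ V ≠ 0 := by
  have hX := RatFunc.X_ne_zero (K := K)
  have hn0 : (n : K) ≠ 0 := by exact_mod_cast (by omega : n ≠ 0)
  obtain ⟨p, q, h, hP, hp, hq⟩ := nsmul_genericPoint_hasValueAtInfty ha hn
  refine ⟨_, _, h, hP, mul_ne_zero (pow_ne_zero _ hX) (hp.ne_zero (by simpa using hn0)), ?_,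
    mul_ne_zero (pow_ne_zero _ hX) (hq.ne_zero (by simpa using hn0))⟩
  rw [mul_comm, ← mul_sub]
  -- The value `4 - 1 / n²` vanishes only if `(2 n)² = 1`, impossible for an integer `n`.
  refine mul_ne_zero (pow_ne_zero _ hX) (((ofNat 4).sub hp).ne_zero fun h0 => ?_)
  have h1 : (2 * n : K) ^ 2 = 1 := by
    field_simp at h0
    linear_combination h0
  have h2 : (2 * n) ^ 2 = 1 := by exact_mod_cast h1
  nlinarith

theorem exists_comesFrom_zsmul_genericPoint {a : K} (ha : a ≠ 0) {n : ℤ} (hn : n ≠ 0) :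
    ∃ T, ComesFrom (RatFunc.C a) RatFunc.X (n • genericPoint a ha) T := by
  have hX := RatFunc.X_ne_zero (K := K)
  obtain ⟨A, V, h, hP, hA, hB, hV⟩ := nsmul_genericPoint_coordinates_ne_zero ha
    (Nat.one_le_iff_ne_zero.2 (Int.natAbs_ne_zero.2 hn))
  have hC : V / RatFunc.X ^ 2 ≠ 0 := div_ne_zero hV (pow_ne_zero 2 hX)
  refine ⟨form (RatFunc.C a) RatFunc.X A (4 * RatFunc.X ^ 4 - A) (V / RatFunc.X ^ 2), ?_⟩
  rcases Int.natAbs_eq n with hm | hm <;> rw [hm]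
  · rw [natCast_zsmul, hP]
    exact ⟨A, V, _, h, rfl, by field_simp, hA, hB, hC, rfl⟩
  · rw [neg_smul, natCast_zsmul, hP, WeierstrassCurve.Affine.Point.neg_some]
    -- Negation only changes the sign of `V`, and `ComesFrom` sees only `V²`, so the same `C` works.
    refine ⟨A, _, _, (WeierstrassCurve.Affine.nonsingular_neg ..).2 h, rfl, ?_, hA, hB, hC, rfl⟩
    simp only [WeierstrassCurve.Affine.negY, curve]
    field_simp
    ring

theorem not_isOfFinAddOrder_genericPoint {a : K} (ha : a ≠ 0) :
    ¬ IsOfFinAddOrder (genericPoint a ha) := by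
  rw [isOfFinAddOrder_iff_nsmul_eq_zero]
  rintro ⟨n, hn, h0⟩
  obtain ⟨A, V, h, hP, -⟩ := nsmul_genericPoint_coordinates_ne_zero ha hn
  exact WeierstrassCurve.Affine.Point.some_ne_zero h (hP.symm.trans h0)

/-- Up to sign, `x / X` takes the value `1 / (2 n)` at infinity for a solution `(x, y, z)` that
comes from `n P`. -/
theorem ComesFrom.hasValueAtInfty_fst {a : K} (ha : a ≠ 0) {n : ℕ} (hn : 1 ≤ n)
    {T : RatFunc K × RatFunc K × RatFunc K}
    (hT : ComesFrom (RatFunc.C a) RatFunc.X (n • genericPoint a ha) T) :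
    HasValueAtInfty ((T.1 / RatFunc.X) ^ 2) (1 / (2 * (n : K)) ^ 2) := by
  have hX := RatFunc.X_ne_zero (K := K)
  have hn0 : (n : K) ≠ 0 := by exact_mod_cast (by omega : n ≠ 0)
  obtain ⟨p, q, h, hP, hp, hq⟩ := nsmul_genericPoint_hasValueAtInfty ha hn
  obtain ⟨A, V, C, hQ, hPQ, hC, hA, hB, hC0, rfl⟩ := hT
  obtain ⟨rfl, rfl⟩ : A = RatFunc.X ^ 4 * p ∧ V = RatFunc.X ^ 6 * q := by
    simpa using hPQ.symm.trans hP
  have hq0 := hq.ne_zero (by simpa using hn0)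
  have hC' : C ^ 2 = RatFunc.X ^ 8 * q ^ 2 :=
    mul_left_cancel₀ (pow_ne_zero 4 hX) (by rw [hC]; ring)
  have hx : ((form (RatFunc.C a) RatFunc.X (RatFunc.X ^ 4 * p)
      (4 * RatFunc.X ^ 4 - RatFunc.X ^ 4 * p) C).1 / RatFunc.X) ^ 2 = p ^ 4 / (2 * q) ^ 2 := by
    simp only [form, div_pow, mul_pow, hC']
    field_simp
  rw [hx]
  convert (hp.pow 4).div (((ofNat 2).mul hq).pow 2) (by simpa using hn0) using 1
  field_simp

/-- Squaring absorbs the free sign of `C`, and also excludes `T = -U`. -/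
theorem ComesFrom.ne_of_ne {a : K} (ha : a ≠ 0) {m n : ℕ} (hm : 1 ≤ m) (hn : 1 ≤ n) (hmn : m ≠ n)
    {T U : RatFunc K × RatFunc K × RatFunc K}
    (hT : ComesFrom (RatFunc.C a) RatFunc.X (m • genericPoint a ha) T)
    (hU : ComesFrom (RatFunc.C a) RatFunc.X (n • genericPoint a ha) U) :
    T.1 ^ 2 ≠ U.1 ^ 2 := by
  intro h
  have hT' := hT.hasValueAtInfty_fst ha hm
  rw [div_pow, h, ← div_pow] at hT'
  have := hT'.unique (hU.hasValueAtInfty_fst ha hn)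
  rw [one_div, one_div, inv_inj] at this
  have h2 : (2 * m) ^ 2 = (2 * n) ^ 2 := by exact_mod_cast this
  exact hmn (by simpa using Nat.pow_left_injective two_ne_zero h2)

theorem infinite_setOf_comesFrom_zsmul_genericPoint {a : K} (ha : a ≠ 0) :
    {T : RatFunc K × RatFunc K × RatFunc K | IsSolution (RatFunc.C a) T ∧
      ∃ n : ℤ, ComesFrom (RatFunc.C a) RatFunc.X (n • genericPoint a ha) T}.Infinite := by
  -- The shift to `n + 1` avoids the zero multiple, from which no triple comes.
  have H : ∀ n : ℕ, ∃ T,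
      ComesFrom (RatFunc.C a) RatFunc.X (((n + 1 : ℕ) : ℤ) • genericPoint a ha) T :=
    fun n => exists_comesFrom_zsmul_genericPoint ha (by omega)
  choose T hT using H
  refine Set.infinite_of_injective_forall_mem (f := T) (fun m n hmn => ?_) fun n =>
    ⟨(hT n).isSolution ((map_ne_zero _).2 ha) RatFunc.X_ne_zero, _, hT n⟩
  by_contra h
  have hm := hT m
  have hn := hT n
  rw [natCast_zsmul] at hm hn
  exact hm.ne_of_ne ha (by omega) (by omega) (by omega) hn (by rw [hmn])

/-- Each factor is homogeneous in `s⁴` and `a`, hence a power of `s` times a polynomial in `t = a /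
s⁴` whose constant term, its value at infinity, is nonzero. -/
theorem generic_factors_ne_zero (a : K) :
    let b := RatFunc.C a
    let s : RatFunc K := RatFunc.X
    27 * s ^ 4 + 4 * b ≠ 0 ∧ s ^ 4 + 12 * b ≠ 0 ∧ s ^ 4 - 4 * b ≠ 0 ∧ 5 * s ^ 4 - 4 * b ≠ 0 ∧
      3 * s ^ 4 + 4 * b ≠ 0 ∧ f₁ b s ≠ 0 ∧ f₂ b s ≠ 0 ∧ f₃ b s ≠ 0 ∧ f₄ b s ≠ 0 := by
  intro b s
  have hX : s ≠ 0 := RatFunc.X_ne_zero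
  obtain ⟨t, ht⟩ : ∃ t, t = b * s⁻¹ ^ 4 := ⟨_, rfl⟩
  have ht0 : HasValueAtInfty t 0 := ht ▸ parameter a
  have hb : b = s ^ 4 * t := by
    rw [ht]
    field_simp
  have key : ∀ (k : ℕ) (g f : RatFunc K) (c : K), HasValueAtInfty f c → c ≠ 0 →
      g = s ^ k * f → g ≠ 0 := fun k g f c hf hc h =>
    h ▸ mul_ne_zero (pow_ne_zero k hX) (hf.ne_zero hc)
  have hn (n : ℕ) [n.AtLeastTwo] := ofNat (K := K) n
  simp only [f₁, f₂, f₃, f₄, hb]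
  refine ⟨key 4 _ _ _ ((hn 27).add ((hn 4).mul ht0)) (by simp) (by ring),
    key 4 _ _ _ (one.add ((hn 12).mul ht0)) (by simp) (by ring),
    key 4 _ _ _ (one.sub ((hn 4).mul ht0)) (by simp) (by ring),
    key 4 _ _ _ ((hn 5).sub ((hn 4).mul ht0)) (by simp) (by ring),
    key 4 _ _ _ ((hn 3).add ((hn 4).mul ht0)) (by simp) (by ring),
    key 12 _ _ _ (((one.sub ((hn 460).mul ht0)).sub ((hn 208).mul (ht0.pow 2))).sub
      ((hn 64).mul (ht0.pow 3))) (by simp) (by ring),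
    key 8 _ _ _ ((one.add ((hn 56).mul ht0)).add ((hn 16).mul (ht0.pow 2))) (by simp) (by ring),
    key 8 _ _ _ ((one.sub ((hn 32).mul ht0)).sub ((hn 16).mul (ht0.pow 2))) (by simp) (by ring),
    key 16 _ _ _ ((((one.add ((hn 1136).mul ht0)).sub ((hn 928).mul (ht0.pow 2))).add
      ((hn 1792).mul (ht0.pow 3))).add ((hn 256).mul (ht0.pow 4))) (by simp) (by ring)⟩

end Generic

end ElkiesFamily

open ElkiesFamily in
theorem mainTheorem2 {K : Type*} [Field K] [CharZero K] [DecidableEq K] [DecidableEq (RatFunc K)]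
    (a : K) (ha : a ≠ 0) :
    -- for values `s` in `K`: the substitution, the curve, `P` and `2P`
    (∀ s : K, s ≠ 0 →
      (∀ A B C : K, A ≠ 0 → B ≠ 0 → C ≠ 0 →
        (IsSolution a (form a s A B C) ↔
          A ^ 3 * B + 4 * a * B ^ 3 + s ^ 4 * C ^ 2 * A - 4 * s ^ 8 * C ^ 2 = 0)) ∧
      (∀ A C : K, A ≠ 0 → 4 * s ^ 4 - A ≠ 0 → C ≠ 0 →
        (IsSolution a (form a s A (4 * s ^ 4 - A) C) ↔
          (s ^ 2 * C) ^ 2 = A ^ 3 + 4 * a * A ^ 2 - 32 * s ^ 4 * a * A + 64 * a * s ^ 8)) ∧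
      (∀ (Q : (curve a s).Point) (T : K × K × K), ComesFrom a s Q T → IsSolution a T) ∧
      (s ^ 4 - 4 * a ≠ 0 → 3 * s ^ 4 + 4 * a ≠ 0 → s ^ 4 + 12 * a ≠ 0 →
        ComesFrom a s (basePoint a s ha) (elkiesSolution a s)) ∧
      (s ^ 4 + 12 * a ≠ 0 →
        ∃ h, 2 • basePoint a s ha = .some
          ((s ^ 16 - 464 * s ^ 12 * a + 1632 * s ^ 8 * a ^ 2 + 768 * a ^ 3 * s ^ 4 + 256 * a ^ 4) /
            (4 * s ^ 4 * (s ^ 4 + 12 * a) ^ 2))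
          (f₃ a s * f₄ a s / (8 * s ^ 6 * (s ^ 4 + 12 * a) ^ 3)) h) ∧
      (s ^ 4 + 12 * a ≠ 0 → s ^ 4 - 4 * a ≠ 0 → 5 * s ^ 4 - 4 * a ≠ 0 → 3 * s ^ 4 + 4 * a ≠ 0 →
        f₁ a s ≠ 0 → f₂ a s ≠ 0 → f₃ a s ≠ 0 → f₄ a s ≠ 0 →
        ComesFrom a s (2 • basePoint a s ha) (newSolution a s))) ∧
    -- for `s` an indeterminate over `K`: infinitely many parametric solutions
    (genericCurve a).IsElliptic ∧
    ¬ IsOfFinAddOrder (genericPoint a ha) ∧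
    ComesFrom (RatFunc.C a) RatFunc.X (genericPoint a ha)
      (elkiesSolution (RatFunc.C a) RatFunc.X) ∧
    ComesFrom (RatFunc.C a) RatFunc.X (2 • genericPoint a ha)
      (newSolution (RatFunc.C a) RatFunc.X) ∧
    newSolution (RatFunc.C a) RatFunc.X ≠ elkiesSolution (RatFunc.C a) RatFunc.X ∧
    newSolution (RatFunc.C a) RatFunc.X ≠ -elkiesSolution (RatFunc.C a) RatFunc.X ∧
    (∀ n : ℤ, n ≠ 0 → ∃ T : RatFunc K × RatFunc K × RatFunc K,
      ComesFrom (RatFunc.C a) RatFunc.X (n • genericPoint a ha) T) ∧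
    {T : RatFunc K × RatFunc K × RatFunc K | IsSolution (RatFunc.C a) T ∧
      ∃ n : ℤ, ComesFrom (RatFunc.C a) RatFunc.X (n • genericPoint a ha) T}.Infinite := by
  have hC : RatFunc.C a ≠ 0 := (map_ne_zero RatFunc.C).2 ha
  have hX := RatFunc.X_ne_zero (K := K)
  obtain ⟨g₀, g₁, g₂, g₃, g₄, hf₁, hf₂, hf₃, hf₄⟩ := generic_factors_ne_zero a
  have hP := comesFrom_elkiesSolution hC g₂ g₄ g₁
  have hP₂ := comesFrom_newSolution hC hX g₁ g₂ g₃ g₄ hf₁ hf₂ hf₃ hf₄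
  have hne := hP₂.ne_of_ne ha (n := 1) (by norm_num) le_rfl (by norm_num) (by rwa [one_smul])
  refine ⟨fun s hs => ⟨fun A B C hA hB hC => isSolution_form_iff ha hs hA hB hC,
    fun A C hA hB hC => isSolution_form_iff_curve ha hs hA hB hC,
    fun Q T h => h.isSolution ha hs, comesFrom_elkiesSolution ha, two_nsmul_basePoint ha hs,
    comesFrom_newSolution ha hs⟩, isElliptic_curve hC hX g₀, not_isOfFinAddOrder_genericPoint ha,
    hP, hP₂, fun h => hne (by rw [h]), fun h => hne (by rw [h, Prod.fst_neg, neg_sq]),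
    fun n hn => exists_comesFrom_zsmul_genericPoint ha hn,
    infinite_setOf_comesFrom_zsmul_genericPoint ha⟩
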